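/- Let $PS$ be a countably infinite set of atomic propositions. Formulas $\alpha,\beta,\gamma$ of propositional logic $PL$ are built from $PS$ with $\neg$ and $\to$ (and $\alpha\lor\beta:=\neg\alpha\to\beta$), with the usual truth relation for assignments $s\colon PS\to\{0,1\}$. Formulas $\varphi,\psi,\vartheta$ of propositional team logic $PTL$ are the closure of $PL$ under a unary connective $\sim$ and binary connectives $\Rightarrow$ and $\multimap$. A team is a (possibly empty) set $T$ of assignments, and: $T\vDash\alpha$ for $\alpha\in PL$ iff $s\vDash\alpha$ for all $s\in T$; $T\vDash{\sim}\varphi$ iff $T\nvDash\varphi$; $T\vDash\varphi\Rightarrow\psi$ iff $T\nvDash\varphi$ or $T\vDash\psi$; $T\vDash\varphi\multimap\psi$ iff for all $S,U$ with $S\cup U=T$, $S\vDash\varphi$ implies $U\vDash\psi$ (lax splitting). For a set $\Phi$ of formulas, $T\vDash\Phi$ means that $T$ satisfies all members of $\Phi$, and $\Phi\vDash\varphi$ means that every team $T$ with $T\vDash\Phi$ has $T\vDash\varphi$. Abbreviate $\varphi\otimes\psi:={\sim}(\varphi\multimap{\sim}\psi)$, $\varphi\sqcap\psi:={\sim}(\varphi\Rightarrow{\sim}\psi)$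 and $\varphi\Leftrightarrow\psi:=(\varphi\Rightarrow\psi)\sqcap(\psi\Rightarrow\varphi)$; implications associate to the right. The proof system $\mathsf{H}^0\mathsf{L}\mathsf{S}$ has the following axioms and rules, for all $\alpha,\beta,\gamma\in PL$ and $\varphi,\psi,\vartheta\in PTL$. * $\mathsf{H}^0$: the axioms $\alpha\to(\beta\to\alpha)$, $(\alpha\to(\beta\to\gamma))\to(\alpha\to\beta)\to(\alpha\to\gamma)$ and $(\neg\alpha\to\neg\beta)\to(\beta\to\alpha)$; the rule: from $\alpha$ and $\alpha\to\beta$ infer $\beta$. * $\mathsf{L}$: the axioms $\varphi\Rightarrow(\psi\Rightarrow\varphi)$, $(\varphi\Rightarrow(\psi\Rightarrow\vartheta))\Rightarrow(\varphi\Rightarrow\psi)\Rightarrow(\varphi\Rightarrow\vartheta)$, $({\sim}\varphi\Rightarrow{\sim}\psi)\Rightarrow(\psi\Rightarrow\varphi)$ and $(\alpha\to\beta)\Rightarrow(\alpha\Rightarrow\beta)$; the rule: from $\varphi$ and $\varphi\Rightarrow\psi$ infer $\psi$. * $\mathsf{S}$: the axioms $(\alpha\otimes\beta)\Leftrightarrow(\alpha\lor\beta)$,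 $\alpha\Rightarrow(\varphi\multimap\alpha)$, $\varphi\Rightarrow(\varphi\multimap\psi)\Rightarrow(\vartheta\multimap\psi)$, $(\varphi\multimap\psi\multimap\vartheta)\Rightarrow(\psi\multimap\varphi\multimap\vartheta)$, $(\varphi\multimap{\sim}\psi)\Rightarrow(\psi\multimap{\sim}\varphi)$ and $(\varphi\multimap(\psi\Rightarrow\vartheta))\Rightarrow(\varphi\multimap\psi)\Rightarrow(\varphi\multimap\vartheta)$; the rule: from $\varphi$ infer $\psi\multimap\varphi$, applicable only if $\varphi$ is a theorem, i.e. derived without premises. Write $\Phi\vdash\varphi$ if $\varphi$ has a finite derivation from premises in $\Phi$ in this system. Then for every set $\Phi$ of $PTL$ formulas and every $PTL$ formula $\varphi$: 1. (Soundness) $\Phi\vdash\varphi$ implies $\Phi\vDash\varphi$. 2. (Completeness) $\Phi\vDash\varphi$ implies $\Phi\vdash\varphi$. 3. (Compactness) If every finite subset of $\Phi$ is satisfied by some team, then $\Phi$ is satisfied by some team; and if $\Phi\vDash\varphi$, then $\Psi\vDash\varphi$ for some finite $\Psi\subseteq\Phi$. -/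

import Mathlib

/-- Formulas of propositional logic `PL` over the set `PS` of atomic propositions. -/
inductive PLForm (PS : Type*) where
  | atom : PS → PLForm PS
  | neg : PLForm PS → PLForm PS
  | imp : PLForm PS → PLForm PS → PLForm PS

namespace PLForm

variable {PS : Type*}

/-- The abbreviation `α ∨ β := ¬α → β`. -/
def or (α β : PLForm PS) : PLForm PS := α.neg.imp β

/-- Classical semantics: truth of a `PL` formula under an assignment `s : PS → {0, 1}`. -/
def Sat (s : PS → Bool) : PLForm PS → Prop
  | atom x => s x = true
  | neg α => ¬ Sat s α
  | imp α β => Sat s α → Sat s β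

end PLForm

/-- Formulas of propositional team logic `PTL`: the closure of `PL` under strong negation `∼`,
material implication `⇾` and linear implication `⊸`. The connectives `¬`, `→` of `PL` apply only
to `PL` formulas. -/
inductive PTLForm (PS : Type*) where
  /-- a classical formula, seen as a team-logical formula -/
  | cl : PLForm PS → PTLForm PS
  /-- strong negation `∼φ` -/
  | sneg : PTLForm PS → PTLForm PS
  /-- material implication `φ ⇾ ψ` -/
  | mimp : PTLForm PS → PTLForm PS → PTLForm PS
  /-- linear implication `φ ⊸ ψ` -/
  | limp : PTLForm PS → PTLForm PS → PTLForm PS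

namespace PTLForm

variable {PS : Type*}

/-- Team conjunction `φ ⩓ ψ := ∼(φ ⇾ ∼ψ)`. -/
def conj (φ ψ : PTLForm PS) : PTLForm PS := (φ.mimp ψ.sneg).sneg

/-- Material equivalence `(φ ⇾ ψ) ⩓ (ψ ⇾ φ)`. -/
def equiv (φ ψ : PTLForm PS) : PTLForm PS := (φ.mimp ψ).conj (ψ.mimp φ)

/-- Splitting disjunction `φ ⊗ ψ := ∼(φ ⊸ ∼ψ)`. -/
def tensor (φ ψ : PTLForm PS) : PTLForm PS := (φ.limp ψ.sneg).sneg

/-- Team semantics with lax splitting. A team is a (possibly empty) set of assignments; a split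
of `T` is any pair `(S, U)` with `S ∪ U = T`, where `S` and `U` may overlap. -/
def Sat (T : Set (PS → Bool)) : PTLForm PS → Prop
  | cl α => ∀ s ∈ T, α.Sat s
  | sneg φ => ¬ Sat T φ
  | mimp φ ψ => Sat T φ → Sat T ψ
  | limp φ ψ => ∀ S U : Set (PS → Bool), S ∪ U = T → Sat S φ → Sat U ψ

/-- The team `T` satisfies every formula of `Φ`. -/
def SatSet (T : Set (PS → Bool)) (Φ : Set (PTLForm PS)) : Prop := ∀ φ ∈ Φ, Sat T φ

/-- `Φ` has a model. -/
def Satisfiable (Φ : Set (PTLForm PS)) : Prop := ∃ T : Set (PS → Bool), SatSet T Φ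

/-- Semantic entailment `Φ ⊨ φ`. -/
def Entails (Φ : Set (PTLForm PS)) (φ : PTLForm PS) : Prop :=
  ∀ T : Set (PS → Bool), SatSet T Φ → Sat T φ

end PTLForm

/-- A proof system over a type `Ξ` of formulas. The rules in `IsThmRule` are those that may be
applied only to theorems, i.e. to formulas derived without using any premise. -/
structure Calculus (Ξ : Type*) where
  IsAxiom : Ξ → Prop
  IsRule : Set Ξ → Ξ → Prop
  IsThmRule : Set Ξ → Ξ → Prop

namespace Calculus

variable {Ξ : Type*}

/-- The component-wise union of two proof systems. -/
def union (Ω Ω' : Calculus Ξ) : Calculus Ξ where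
  IsAxiom ξ := Ω.IsAxiom ξ ∨ Ω'.IsAxiom ξ
  IsRule Δ ξ := Ω.IsRule Δ ξ ∨ Ω'.IsRule Δ ξ
  IsThmRule Δ ξ := Ω.IsThmRule Δ ξ ∨ Ω'.IsThmRule Δ ξ

/-- `Ω.Derives Φ ξ`: there is a (finite) `Ω`-proof of `ξ` from the premises `Φ`. -/
inductive Derives (Ω : Calculus Ξ) : Set Ξ → Ξ → Prop
  | premise {Φ : Set Ξ} {ξ : Ξ} (h : ξ ∈ Φ) : Derives Ω Φ ξ
  | ax {Φ : Set Ξ} {ξ : Ξ} (h : Ω.IsAxiom ξ) : Derives Ω Φ ξ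
  | rule {Φ Δ : Set Ξ} {ξ : Ξ} (hr : Ω.IsRule Δ ξ) (hfin : Δ.Finite)
      (h : ∀ δ ∈ Δ, Derives Ω Φ δ) : Derives Ω Φ ξ
  | thmRule {Φ Δ : Set Ξ} {ξ : Ξ} (hr : Ω.IsThmRule Δ ξ) (hfin : Δ.Finite)
      (h : ∀ δ ∈ Δ, Derives Ω ∅ δ) : Derives Ω Φ ξ

end Calculus

section Systems

open PTLForm

variable {PS : Type*}

/-- The axioms of `H⁰`, for classical formulas only. -/
inductive AxH0 : PTLForm PS → Prop
  | A1 (α β : PLForm PS) : AxH0 (cl (α.imp (β.imp α)))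
  | A2 (α β γ : PLForm PS) :
      AxH0 (cl ((α.imp (β.imp γ)).imp ((α.imp β).imp (α.imp γ))))
  | A3 (α β : PLForm PS) : AxH0 (cl ((α.neg.imp β.neg).imp (β.imp α)))

/-- Modus ponens for `→`. -/
inductive RuleH0 : Set (PTLForm PS) → PTLForm PS → Prop
  | mp (α β : PLForm PS) : RuleH0 {cl α, cl (α.imp β)} (cl β)

/-- The axioms of `L`. -/
inductive AxL : PTLForm PS → Prop
  | L1 (φ ψ : PTLForm PS) : AxL (φ.mimp (ψ.mimp φ))
  | L2 (φ ψ θ : PTLForm PS) :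
      AxL ((φ.mimp (ψ.mimp θ)).mimp ((φ.mimp ψ).mimp (φ.mimp θ)))
  | L3 (φ ψ : PTLForm PS) : AxL ((φ.sneg.mimp ψ.sneg).mimp (ψ.mimp φ))
  | L4 (α β : PLForm PS) : AxL ((cl (α.imp β)).mimp ((cl α).mimp (cl β)))

/-- Modus ponens for `⇾`. -/
inductive RuleL : Set (PTLForm PS) → PTLForm PS → Prop
  | mp (φ ψ : PTLForm PS) : RuleL {φ, φ.mimp ψ} ψ

/-- The axioms of `S`. -/
inductive AxS : PTLForm PS → Prop
  /-- `(α ⊗ β) ⟺ (α ∨ β)` -/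
  | flatTensor (α β : PLForm PS) : AxS (((cl α).tensor (cl β)).equiv (cl (α.or β)))
  /-- `α ⇾ (φ ⊸ α)` -/
  | flatLimp (α : PLForm PS) (φ : PTLForm PS) : AxS ((cl α).mimp (φ.limp (cl α)))
  /-- `φ ⇾ (φ ⊸ ψ) ⇾ (θ ⊸ ψ)` -/
  | lax (φ ψ θ : PTLForm PS) : AxS (φ.mimp ((φ.limp ψ).mimp (θ.limp ψ)))
  /-- `(φ ⊸ ψ ⊸ θ) ⇾ (ψ ⊸ φ ⊸ θ)` -/
  | exch (φ ψ θ : PTLForm PS) :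
      AxS ((φ.limp (ψ.limp θ)).mimp (ψ.limp (φ.limp θ)))
  /-- `(φ ⊸ ∼ψ) ⇾ (ψ ⊸ ∼φ)` -/
  | contra (φ ψ : PTLForm PS) : AxS ((φ.limp ψ.sneg).mimp (ψ.limp φ.sneg))
  /-- `(φ ⊸ (ψ ⇾ θ)) ⇾ (φ ⊸ ψ) ⇾ (φ ⊸ θ)` -/
  | dist (φ ψ θ : PTLForm PS) :
      AxS ((φ.limp (ψ.mimp θ)).mimp ((φ.limp ψ).mimp (φ.limp θ)))

/-- Necessitation: from a theorem `φ` infer `ψ ⊸ φ`. -/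
inductive ThmRuleS : Set (PTLForm PS) → PTLForm PS → Prop
  | nec (φ ψ : PTLForm PS) : ThmRuleS {φ} (ψ.limp φ)

variable (PS)

/-- The system `H⁰`. -/
def sysH0 : Calculus (PTLForm PS) where
  IsAxiom := AxH0
  IsRule := RuleH0
  IsThmRule _ _ := False

/-- The system `L` of lifted propositional axioms. -/
def sysL : Calculus (PTLForm PS) where
  IsAxiom := AxL
  IsRule := RuleL
  IsThmRule _ _ := False

/-- The system `S` of splitting axioms. -/
def sysS : Calculus (PTLForm PS) where
  IsAxiom := AxS
  IsRule _ _ := False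
  IsThmRule := ThmRuleS

/-- The system `H⁰LS`. -/
def sysH0LS : Calculus (PTLForm PS) := ((sysH0 PS).union (sysL PS)).union (sysS PS)

end Systems

/-! Completeness goes by maximal consistent sets (MCS). If `Φ` does not derive `φ`, Lindenbaum gives
an MCS `M` containing `Φ` but not `φ`, and the candidate model is `team M`, the set of all
assignments satisfying the classical formulas of `M`. The truth lemma is not proved by direct
induction on satisfaction. By soundness, the formulas true in any team form an MCS, and by
completeness of `H⁰` the one for `team M` has the same classical part as `M`. So it suffices that an
MCS is determined by its classical part (`mem_iff_of_cl_mem_iff`). The hard case there is `⊸`. A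
tensor in `M` is witnessed by a split of `M` into two MCS (`exists_split`). An MCS `M'` with the
same classical part must then split into MCS with the same classical parts as these two, after which
induction applies. This needs only that `M'` contains the tensor of any finite descriptions of the
two parts; `tensor_literals` provides it, adding negative classical facts one at a time by lax
splitting. Compactness follows from finiteness of derivations. -/

/-! ### Abstract Hilbert-style theories and Lindenbaum's lemma, used for both `PL` and `PTL`. -/

section Hilbert

/-- A set of formulas containing the Hilbert axioms for `imp` and `neg` and closed under
modus ponens. -/
structure IsTheory {F : Type*} (imp : F → F → F) (neg : F → F) (X : Set F) : Prop where
  k : ∀ a b, imp a (imp b a) ∈ X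
  s : ∀ a b c, imp (imp a (imp b c)) (imp (imp a b) (imp a c)) ∈ X
  c : ∀ a b, imp (imp (neg a) (neg b)) (imp b a) ∈ X
  mp : ∀ {a b}, imp a b ∈ X → a ∈ X → b ∈ X

/-- A theory containing exactly one of `a`, `neg a` for every formula `a`. -/
structure IsCompleteTheory {F : Type*} (imp : F → F → F) (neg : F → F) (X : Set F) : Prop
    extends IsTheory imp neg X where
  neg_mem : ∀ a, neg a ∈ X ↔ a ∉ X

variable {F : Type*} {imp : F → F → F} {neg : F → F} {X : Set F}

namespace IsTheory

theorem weaken (h : IsTheory imp neg X) {a : F} (b : F) (ha : a ∈ X) : imp b a ∈ X :=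
  h.mp (h.k a b) ha

theorem imp_self (h : IsTheory imp neg X) (a : F) : imp a a ∈ X :=
  h.mp (h.mp (h.s a (imp a a) a) (h.k _ _)) (h.k _ _)

/-- The theory obtained by adding the hypothesis `a`. -/
theorem adjoin (h : IsTheory imp neg X) (a : F) : IsTheory imp neg {b | imp a b ∈ X} where
  k _ _ := h.weaken _ (h.k _ _)
  s _ _ _ := h.weaken _ (h.s _ _ _)
  c _ _ := h.weaken _ (h.c _ _)
  mp h₁ h₂ := h.mp (h.mp (h.s _ _ _) h₁) h₂

theorem explosion (h : IsTheory imp neg X) {a : F} (b : F) (ha : a ∈ X) (hn : neg a ∈ X) :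
    b ∈ X :=
  h.mp (h.mp (h.c b a) (h.weaken _ hn)) ha

theorem by_contradiction (h : IsTheory imp neg X) {a : F} (ha : imp (neg a) a ∈ X) : a ∈ X := by
  -- Under the hypothesis `neg a` everything follows, in particular the negation of an axiom;
  -- contraposition then yields `a`.
  have h₁ : imp (neg a) (neg (imp a (imp a a))) ∈ X :=
    (h.adjoin (neg a)).explosion (a := a) _ ha (h.imp_self _)
  exact h.mp (h.mp (h.c _ _) h₁) (h.k _ _)

theorem imp_of_neg_mem (h : IsTheory imp neg X) {a : F} (b : F) (ha : neg a ∈ X) :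
    imp a b ∈ X :=
  (h.adjoin a).explosion (a := a) b (h.imp_self a) (h.weaken a ha)

/-- Proof by cases. -/
theorem or_elim (h : IsTheory imp neg X) {a b : F} (h₁ : imp a b ∈ X)
    (h₂ : imp (neg a) b ∈ X) : b ∈ X := by
  have hA := h.adjoin (neg b)
  refine h.by_contradiction ?_
  refine hA.mp (h.weaken _ h₂) ?_
  refine hA.by_contradiction ?_
  have hB := hA.adjoin (neg (neg a))
  have ha : a ∈ {c | imp (neg (neg a)) c ∈ {c | imp (neg b) c ∈ X}} :=
    hB.by_contradiction
      (hB.imp_of_neg_mem a (hA.imp_self (neg (neg a))))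
  exact hB.explosion (a := b) _
    (hB.mp (hA.weaken _ (h.weaken _ h₁)) ha) (hA.weaken _ (h.imp_self _))

/-- `neg a → b` acts as a disjunction. -/
theorem or_imp (h : IsTheory imp neg X) {a b d : F} (h₁ : imp a d ∈ X) (h₂ : imp b d ∈ X) :
    imp (imp (neg a) b) d ∈ X := by
  have hA := h.adjoin (imp (neg a) b)
  refine hA.or_elim (a := a) (h.weaken _ h₁) ?_
  exact (hA.adjoin (neg a)).mp (hA.weaken _ (h.weaken _ h₂)) (h.imp_self _)

/-- Lindenbaum's lemma: a theory disjoint from a nonempty set closed under disjunction extends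
to a complete theory disjoint from it. -/
theorem exists_complete (h : IsTheory imp neg X) {I : Set F} (hI : I.Nonempty)
    (hor : ∀ a ∈ I, ∀ b ∈ I, imp (neg a) b ∈ I) (hdisj : ∀ a ∈ X, a ∉ I) :
    ∃ M, X ⊆ M ∧ IsCompleteTheory imp neg M ∧ ∀ a ∈ M, a ∉ I := by
  obtain ⟨M, hXM, hM⟩ := zorn_subset_nonempty
    {M | IsTheory imp neg M ∧ ∀ a ∈ M, a ∉ I} (by
      intro C hC hchain ⟨Y, hY⟩
      refine ⟨⋃₀ C, ⟨⟨?_, ?_, ?_, ?_⟩, ?_⟩, fun _ => Set.subset_sUnion_of_mem⟩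
      · exact fun a b => ⟨Y, hY, (hC hY).1.k a b⟩
      · exact fun a b c => ⟨Y, hY, (hC hY).1.s a b c⟩
      · exact fun a b => ⟨Y, hY, (hC hY).1.c a b⟩
      · rintro a b ⟨Z, hZ, hab⟩ ⟨W, hW, ha⟩
        rcases hchain.total hZ hW with hs | hs
        · exact ⟨W, hW, (hC hW).1.mp (hs hab) ha⟩
        · exact ⟨Z, hZ, (hC hZ).1.mp hab (hs ha)⟩
      · rintro a ⟨Z, hZ, ha⟩
        exact (hC hZ).2 a ha) X ⟨h, hdisj⟩
  obtain ⟨hMt, hMI⟩ := hM.prop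
  -- By maximality, adjoining a missing formula must produce an element of `I`.
  have key : ∀ a, a ∉ M → ∃ b ∈ I, imp a b ∈ M := by
    intro a ha
    by_contra! hb
    have hle : M ⊆ {b | imp a b ∈ M} := fun b hb => hMt.weaken a hb
    exact ha (hM.le_of_ge (y := {b | imp a b ∈ M})
      ⟨hMt.adjoin a, fun b hb' hbI => hb b hbI hb'⟩ hle (hMt.imp_self a))
  refine ⟨M, hXM, ⟨hMt, fun a => ⟨fun hn ha => ?_, fun ha => ?_⟩⟩, hMI⟩
  · obtain ⟨i, hi⟩ := hI
    exact hMI i (hMt.explosion i ha hn) hi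
  · by_contra hn
    obtain ⟨b, hbI, hb⟩ := key a ha
    obtain ⟨d, hdI, hd⟩ := key _ hn
    refine hMI _ ?_ (hor b hbI d hdI)
    have hA := hMt.adjoin (neg b)
    refine hA.or_elim (a := a) ?_ (hMt.weaken _ hd)
    exact (hA.adjoin a).explosion (a := b) _ (hMt.weaken _ hb)
      (hA.weaken _ (hMt.imp_self _))

theorem exists_complete_not_mem (h : IsTheory imp neg X) {a : F} (ha : a ∉ X) :
    ∃ M, X ⊆ M ∧ IsCompleteTheory imp neg M ∧ a ∉ M := by
  -- The ideal to avoid consists of all formulas that imply `a` over `X`.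
  obtain ⟨M, hXM, hM, hI⟩ := h.exists_complete (I := {b | imp b a ∈ X}) ⟨a, h.imp_self a⟩
    (fun b hb d hd => h.or_imp hb hd) (fun b hb hba => ha (h.mp hba hb))
  exact ⟨M, hXM, hM, fun hm => hI a hm (h.imp_self a)⟩

end IsTheory

theorem IsCompleteTheory.imp_mem (h : IsCompleteTheory imp neg X) (a b : F) :
    imp a b ∈ X ↔ (a ∈ X → b ∈ X) := by
  refine ⟨fun hab => h.mp hab, fun hab => ?_⟩
  by_cases ha : a ∈ X
  · exact h.weaken a (hab ha)
  · exact h.imp_of_neg_mem b ((h.neg_mem a).2 ha)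

end Hilbert

/-! ### Soundness. -/

section Soundness

variable {PS : Type*}

open PTLForm

theorem sat_of_isAxiom {φ : PTLForm PS} (h : (sysH0LS PS).IsAxiom φ) (T : Set (PS → Bool)) :
    Sat T φ := by
  rcases h with (h | h) | h
  · rcases h with ⟨α, β⟩ | ⟨α, β, γ⟩ | ⟨α, β⟩ <;> intro s _ <;> simp only [PLForm.Sat] <;> tauto
  · rcases h with ⟨φ, ψ⟩ | ⟨φ, ψ, θ⟩ | ⟨φ, ψ⟩ | ⟨α, β⟩
    · simp only [Sat]; tauto
    · simp only [Sat]; tauto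
    · simp only [Sat]; tauto
    · exact fun h h' s hs => h s hs (h' s hs)
  · rcases h with ⟨α, β⟩ | ⟨α, φ⟩ | ⟨φ, ψ, θ⟩ | ⟨φ, ψ, θ⟩ | ⟨φ, ψ⟩ | ⟨φ, ψ, θ⟩
    · have key : Sat T ((cl α).tensor (cl β)) ↔ Sat T (cl (α.or β)) := by
        refine ⟨fun h s hs hα => ?_, fun h hn => ?_⟩
        · by_contra hβ
          refine h ?_
          rintro S U rfl hS hU
          exact hs.elim (fun hs => hα (hS s hs)) fun hs => hβ (hU s hs)
        · refine hn {s ∈ T | α.Sat s} {s ∈ T | β.Sat s} ?_ (fun s hs => hs.2) fun s hs => hs.2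
          ext s
          have : s ∈ T → ¬ α.Sat s → β.Sat s := h s
          simp only [Set.mem_union, Set.mem_ofPred_eq]
          tauto
      exact fun h => h key.1 key.2
    · rintro h S U rfl - s hs
      exact h s (Or.inr hs)
    · rintro h h' S U rfl -
      -- Lax splitting lets the whole team serve as the left part, overlapping `U`.
      exact h' (S ∪ U) U (by simp) h
    · rintro h S U rfl hS V W rfl hV
      exact h V (S ∪ W) (by rw [Set.union_left_comm]) hV S W rfl hS
    · rintro h S U rfl hS hU
      exact h U S (Set.union_comm _ _) hU hS
    · rintro h h' S U hT hS
      exact h S U hT hS (h' S U hT hS)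

theorem soundness {Φ : Set (PTLForm PS)} {φ : PTLForm PS}
    (h : (sysH0LS PS).Derives Φ φ) : Entails Φ φ := by
  induction h with
  | premise h => exact fun T hT => hT _ h
  | ax h => exact fun T _ => sat_of_isAxiom h T
  | rule hr _ _ ih =>
    intro T hT
    rcases hr with (⟨α, β⟩ | ⟨φ, ψ⟩) | hr
    · exact fun s hs => ih _ (Or.inr rfl) T hT s hs (ih _ (Or.inl rfl) T hT s hs)
    · exact ih _ (Or.inr rfl) T hT (ih _ (Or.inl rfl) T hT)
    · exact hr.elim
  | thmRule hr _ _ ih =>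
    intro T hT
    rcases hr with (hr | hr) | ⟨φ, ψ⟩
    · exact hr.elim
    · exact hr.elim
    · exact fun S U _ _ => ih _ rfl U (fun _ h => h.elim)

end Soundness

/-! ### Basic properties of derivations. -/

section Derivations

variable {PS : Type*} {Φ : Set (PTLForm PS)}

open PTLForm

theorem derives_mono {Ξ : Type*} {Ω : Calculus Ξ} {Φ Ψ : Set Ξ} {ξ : Ξ} (h : Ω.Derives Φ ξ)
    (hs : Φ ⊆ Ψ) : Ω.Derives Ψ ξ := by
  induction h with
  | premise h => exact .premise (hs h)
  | ax h => exact .ax h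
  | rule hr hfin _ ih => exact .rule hr hfin fun δ hδ => ih δ hδ hs
  | thmRule hr hfin h _ => exact .thmRule hr hfin h

theorem exists_finite_derives {Ξ : Type*} {Ω : Calculus Ξ} {Φ : Set Ξ} {ξ : Ξ}
    (h : Ω.Derives Φ ξ) : ∃ Ψ ⊆ Φ, Ψ.Finite ∧ Ω.Derives Ψ ξ := by
  induction h with
  | @premise Φ ξ h => exact ⟨{ξ}, by simpa using h, Set.finite_singleton ξ, .premise rfl⟩
  | ax h => exact ⟨∅, Set.empty_subset _, Set.finite_empty, .ax h⟩
  | @rule Φ Δ ξ hr hfin _ ih =>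
    choose! Ψ h₁ h₂ h₃ using ih
    exact ⟨⋃ δ ∈ Δ, Ψ δ, Set.iUnion₂_subset h₁, hfin.biUnion h₂,
      .rule hr hfin fun δ hδ => derives_mono (h₃ δ hδ) (Set.subset_biUnion_of_mem hδ)⟩
  | thmRule hr hfin h _ => exact ⟨∅, Set.empty_subset _, Set.finite_empty, .thmRule hr hfin h⟩

theorem derives_mp {φ ψ : PTLForm PS} (h : (sysH0LS PS).Derives Φ (φ.mimp ψ))
    (h' : (sysH0LS PS).Derives Φ φ) : (sysH0LS PS).Derives Φ ψ :=
  .rule (Or.inl (Or.inr (RuleL.mp φ ψ))) (by simp) (by simp [h, h'])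

theorem derives_H0 {φ : PTLForm PS} (h : AxH0 φ) : (sysH0LS PS).Derives Φ φ :=
  .ax (Or.inl (Or.inl h))

theorem derives_L {φ : PTLForm PS} (h : AxL φ) : (sysH0LS PS).Derives Φ φ :=
  .ax (Or.inl (Or.inr h))

theorem derives_S {φ : PTLForm PS} (h : AxS φ) : (sysH0LS PS).Derives Φ φ :=
  .ax (Or.inr h)

theorem derives_nec {φ : PTLForm PS} (ψ : PTLForm PS) (h : (sysH0LS PS).Derives ∅ φ) :
    (sysH0LS PS).Derives Φ (ψ.limp φ) :=
  .thmRule (Or.inr (ThmRuleS.nec φ ψ)) (by simp) (by simpa using h)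

theorem isTheory_derives (Φ : Set (PTLForm PS)) :
    IsTheory mimp sneg {φ | (sysH0LS PS).Derives Φ φ} where
  k φ ψ := derives_L (.L1 φ ψ)
  s φ ψ θ := derives_L (.L2 φ ψ θ)
  c φ ψ := derives_L (.L3 φ ψ)
  mp := derives_mp

end Derivations

/-- Maximal consistent sets of `PTL` formulas. -/
structure IsMCS {PS : Type*} (M : Set (PTLForm PS)) : Prop
    extends IsCompleteTheory PTLForm.mimp PTLForm.sneg M where
  thm_mem : ∀ φ, (sysH0LS PS).Derives ∅ φ → φ ∈ M

/-- Replaces explicit Hilbert derivations by propositional reasoning about membership in an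
arbitrary MCS. -/
theorem derives_of_forall_isMCS {PS : Type*} {φ : PTLForm PS}
    (h : ∀ M, IsMCS M → φ ∈ M) : (sysH0LS PS).Derives ∅ φ := by
  by_contra hn
  obtain ⟨M, hM, hc, hφ⟩ := (isTheory_derives ∅).exists_complete_not_mem (a := φ) hn
  exact hφ (h M ⟨hc, fun ψ hψ => hM hψ⟩)

theorem isMCS_setOf_sat {PS : Type*} (T : Set (PS → Bool)) :
    IsMCS {φ : PTLForm PS | PTLForm.Sat T φ} where
  k _ _ := fun h _ => h
  s _ _ _ := fun h h' h'' => h h'' (h' h'')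
  c _ _ := fun h h' => by_contra fun hn => h hn h'
  mp h := h
  neg_mem _ := Iff.rfl
  thm_mem _ h := soundness h T (fun _ h => h.elim)

/-! ### Classical formulas and the tensor in an MCS. -/

namespace IsMCS

open PTLForm

variable {PS : Type*} {M : Set (PTLForm PS)}

theorem conj_mem (hM : IsMCS M) {φ ψ : PTLForm PS} : φ.conj ψ ∈ M ↔ φ ∈ M ∧ ψ ∈ M := by
  simp only [conj, hM.neg_mem, hM.imp_mem]
  tauto

theorem isTheory_flat (hM : IsMCS M) : IsTheory PLForm.imp PLForm.neg {α | cl α ∈ M} where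
  k α β := hM.thm_mem _ (derives_H0 (.A1 α β))
  s α β γ := hM.thm_mem _ (derives_H0 (.A2 α β γ))
  c α β := hM.thm_mem _ (derives_H0 (.A3 α β))
  mp h h' := hM.mp (hM.mp (hM.thm_mem _ (derives_L (.L4 _ _))) h) h'

/-- The assignments satisfying all classical formulas of `M`. -/
def team (M : Set (PTLForm PS)) : Set (PS → Bool) := {s | ∀ α, cl α ∈ M → α.Sat s}

/-- Strong completeness of `H⁰`, for the classical part of a maximal consistent set. -/
theorem cl_mem_iff (hM : IsMCS M) {α : PLForm PS} : cl α ∈ M ↔ ∀ s ∈ team M, α.Sat s := by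
  classical
  refine ⟨fun h s hs => hs α h, fun h => by_contra fun hn => ?_⟩
  obtain ⟨N, hMN, hN, hα⟩ := hM.isTheory_flat.exists_complete_not_mem (a := α) hn
  have key : ∀ β : PLForm PS, β.Sat (fun x => decide (PLForm.atom x ∈ N)) ↔ β ∈ N := by
    intro β
    induction β with
    | atom x => simp [PLForm.Sat]
    | neg β ih => simp only [PLForm.Sat, hN.neg_mem, ih]
    | imp β γ ih ih' => simp only [PLForm.Sat, hN.imp_mem, ih, ih']
  exact hα ((key α).1 (h _ fun β hβ => (key β).2 (hMN hβ)))

theorem nec (hM : IsMCS M) {φ : PTLForm PS} (ψ : PTLForm PS) (h : ∀ N, IsMCS N → φ ∈ N) :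
    ψ.limp φ ∈ M :=
  hM.thm_mem _ (derives_nec ψ (derives_of_forall_isMCS h))

theorem limp_mp (hM : IsMCS M) {φ ψ θ : PTLForm PS} (h : φ.limp (ψ.mimp θ) ∈ M)
    (h' : φ.limp ψ ∈ M) : φ.limp θ ∈ M :=
  hM.mp (hM.mp (hM.thm_mem _ (derives_S (.dist φ ψ θ))) h) h'

theorem limp_mono (hM : IsMCS M) {φ ψ θ : PTLForm PS} (h : φ.limp ψ ∈ M)
    (hi : ∀ N, IsMCS N → ψ ∈ N → θ ∈ N) : φ.limp θ ∈ M :=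
  hM.limp_mp (hM.nec φ fun N hN => (hN.imp_mem _ _).2 (hi N hN)) h

theorem limp_mono₂ (hM : IsMCS M) {φ ψ ψ' θ : PTLForm PS} (h : φ.limp ψ ∈ M)
    (h' : φ.limp ψ' ∈ M) (hi : ∀ N, IsMCS N → ψ ∈ N → ψ' ∈ N → θ ∈ N) : φ.limp θ ∈ M := by
  refine hM.limp_mp (hM.limp_mono h (θ := ψ'.mimp θ) fun N hN hψ => ?_) h'
  exact (hN.imp_mem _ _).2 (hi N hN hψ)

theorem tensor_mem (hM : IsMCS M) {φ ψ : PTLForm PS} :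
    φ.tensor ψ ∈ M ↔ φ.limp ψ.sneg ∉ M := hM.neg_mem _

theorem limp_mem (hM : IsMCS M) {φ ψ : PTLForm PS} :
    φ.limp ψ ∈ M ↔ φ.tensor ψ.sneg ∉ M := by
  rw [hM.tensor_mem, not_not]
  constructor <;> intro h <;> refine hM.limp_mono h fun N hN => ?_ <;>
    simp only [hN.neg_mem, not_not, imp_self]

theorem tensor_comm (hM : IsMCS M) {φ ψ : PTLForm PS} (h : φ.tensor ψ ∈ M) :
    ψ.tensor φ ∈ M := by
  rw [hM.tensor_mem] at h ⊢
  exact fun h' => h (hM.mp (hM.thm_mem _ (derives_S (.contra ψ φ))) h')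

/-- Distributivity of the tensor over disjunction, together with monotonicity. -/
theorem tensor_or (hM : IsMCS M) {φ ψ θ θ' : PTLForm PS} (h : φ.tensor ψ ∈ M)
    (hi : ∀ N, IsMCS N → ψ ∈ N → θ ∈ N ∨ θ' ∈ N) :
    φ.tensor θ ∈ M ∨ φ.tensor θ' ∈ M := by
  simp only [hM.tensor_mem] at h ⊢
  by_contra! hn
  refine h (hM.limp_mono₂ hn.1 hn.2 fun N hN h₁ h₂ => ?_)
  have := hi N hN
  simp only [hN.neg_mem] at h₁ h₂ ⊢
  tauto

theorem tensor_mono (hM : IsMCS M) {φ ψ θ : PTLForm PS} (h : φ.tensor ψ ∈ M)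
    (hi : ∀ N, IsMCS N → ψ ∈ N → θ ∈ N) : φ.tensor θ ∈ M :=
  (hM.tensor_or h fun N hN hψ => Or.inl (hi N hN hψ)).elim id id

theorem tensor_cl (hM : IsMCS M) {α β : PLForm PS} :
    (cl α).tensor (cl β) ∈ M ↔ ∀ s ∈ team M, α.Sat s ∨ β.Sat s := by
  have h := hM.thm_mem _ (derives_S (.flatTensor α β))
  rw [PTLForm.equiv, hM.conj_mem, hM.imp_mem, hM.imp_mem] at h
  rw [Iff.intro h.1 h.2, hM.cl_mem_iff]
  simp only [PLForm.or, PLForm.Sat, or_iff_not_imp_left]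

/-- The tensor with a false classical formula is false. -/
theorem sneg_cl_mem_of_tensor (hM : IsMCS M) {φ : PTLForm PS} {α : PLForm PS}
    (h : φ.tensor (cl α).sneg ∈ M) : (cl α).sneg ∈ M := by
  rw [hM.neg_mem]
  exact fun hα => hM.limp_mem.1 (hM.mp (hM.thm_mem _ (derives_S (.flatLimp α φ))) hα) h

theorem tensor_lax (hM : IsMCS M) {φ ψ θ : PTLForm PS} (hφ : φ ∈ M) (h : θ.tensor ψ ∈ M) :
    φ.tensor ψ ∈ M := by
  rw [hM.tensor_mem] at h ⊢
  exact fun h' => h (hM.mp (hM.mp (hM.thm_mem _ (derives_S (.lax φ _ θ))) hφ) h')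

theorem tensor_left_comm (hM : IsMCS M) {φ ψ θ : PTLForm PS}
    (h : φ.tensor (ψ.tensor θ) ∈ M) : ψ.tensor (φ.tensor θ) ∈ M := by
  have key : ∀ φ ψ : PTLForm PS, φ.tensor (ψ.tensor θ) ∈ M ↔
      φ.limp (ψ.limp θ.sneg) ∉ M := by
    intro φ ψ
    rw [hM.limp_mem, not_not]
    rfl
  rw [key] at h ⊢
  exact fun h' => h (hM.mp (hM.thm_mem _ (derives_S (.exch _ _ _))) h')

/-! ### Splitting an MCS into two. -/

/-- `X` is downward directed with respect to provable implication. -/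
def IsDirected (X : Set (PTLForm PS)) : Prop :=
  X.Nonempty ∧ ∀ a ∈ X, ∀ b ∈ X, ∃ c ∈ X, ∀ N, IsMCS N → c ∈ N → a ∈ N ∧ b ∈ N

theorem isDirected_singleton (φ : PTLForm PS) : IsDirected {φ} :=
  ⟨⟨φ, rfl⟩, fun _ ha _ hb => ⟨φ, rfl, fun _ _ h => ⟨ha ▸ h, hb ▸ h⟩⟩⟩

theorem isDirected [Nonempty PS] (hM : IsMCS M) : IsDirected M :=
  ⟨⟨_, hM.imp_self (cl (.atom (Classical.arbitrary PS)))⟩, fun a ha b hb =>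
    ⟨a.conj b, hM.conj_mem.2 ⟨ha, hb⟩, fun _ hN => hN.conj_mem.1⟩⟩

/-- Formulas `c` with `c ⊗ b ∉ M` for some `b ∈ Y` are closed under disjunction, since `⊗`
distributes over it and `Y` is directed. Lindenbaum extends the theory generated by `X` while
avoiding them. -/
theorem exists_isMCS_tensor_left (hM : IsMCS M) {X Y : Set (PTLForm PS)} (hX : IsDirected X)
    (hY : IsDirected Y) (h : ∀ a ∈ X, ∀ b ∈ Y, a.tensor b ∈ M) :
    ∃ N, IsMCS N ∧ X ⊆ N ∧ ∀ a ∈ N, ∀ b ∈ Y, a.tensor b ∈ M := by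
  obtain ⟨x, hx⟩ := hX.1
  obtain ⟨y, hy⟩ := hY.1
  have hth : ∀ φ, (∀ N, IsMCS N → φ ∈ N) → φ ∈ {c | ∃ a ∈ X, ∀ N, IsMCS N → a ∈ N → c ∈ N} :=
    fun φ hφ => ⟨x, hx, fun N hN _ => hφ N hN⟩
  have hT : IsTheory mimp sneg {c | ∃ a ∈ X, ∀ N, IsMCS N → a ∈ N → c ∈ N} := by
    refine ⟨fun a b => hth _ fun N hN => hN.k a b, fun a b c => hth _ fun N hN => hN.s a b c,
      fun a b => hth _ fun N hN => hN.c a b, ?_⟩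
    rintro a b ⟨u, hu, hu'⟩ ⟨v, hv, hv'⟩
    obtain ⟨w, hw, hw'⟩ := hX.2 u hu v hv
    exact ⟨w, hw, fun N hN h => hN.mp (hu' N hN (hw' N hN h).1) (hv' N hN (hw' N hN h).2)⟩
  have hI : {c : PTLForm PS | ∃ b ∈ Y, c.tensor b ∉ M}.Nonempty := by
    refine ⟨(y.mimp y).sneg, y, hy, fun hn => ?_⟩
    refine hM.limp_mem.1 (hM.nec y fun N hN => ?_) (hM.tensor_comm hn)
    exact hN.imp_self y
  obtain ⟨N, hXN, hN, hNI⟩ := hT.exists_complete hI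
    (by
      rintro a ⟨b, hb, hab⟩ a' ⟨b', hb', hab'⟩
      obtain ⟨d, hd, hd'⟩ := hY.2 b hb b' hb'
      refine ⟨d, hd, fun hn => ?_⟩
      rcases hM.tensor_or (hM.tensor_comm hn) (θ := a) (θ' := a') (fun N hN h => by
        rw [hN.imp_mem, hN.neg_mem] at h
        tauto) with h | h
      · exact hab (hM.tensor_mono (hM.tensor_comm h) fun N hN h => (hd' N hN h).1)
      · exact hab' (hM.tensor_mono (hM.tensor_comm h) fun N hN h => (hd' N hN h).2))
    (by
      rintro c ⟨a, ha, hac⟩ ⟨b, hb, hcb⟩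
      exact hcb (hM.tensor_comm (hM.tensor_mono (hM.tensor_comm (h a ha b hb)) hac)))
  refine ⟨N, ⟨hN, fun φ hφ => hXN (hth φ fun N hN => hN.thm_mem φ hφ)⟩,
    fun a ha => hXN ⟨a, ha, fun _ _ h => h⟩, fun a ha b hb => ?_⟩
  by_contra hn
  exact hNI a ha ⟨b, hb, hn⟩

/-- Existence of a splitting of a maximal consistent set. -/
theorem exists_split [Nonempty PS] (hM : IsMCS M) {X Y : Set (PTLForm PS)} (hX : IsDirected X)
    (hY : IsDirected Y) (h : ∀ a ∈ X, ∀ b ∈ Y, a.tensor b ∈ M) :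
    ∃ N N', IsMCS N ∧ IsMCS N' ∧ X ⊆ N ∧ Y ⊆ N' ∧ ∀ a ∈ N, ∀ b ∈ N', a.tensor b ∈ M := by
  obtain ⟨N, hN, hXN, hNY⟩ := hM.exists_isMCS_tensor_left hX hY h
  obtain ⟨N', hN', hYN', hNN'⟩ := hM.exists_isMCS_tensor_left hY hN.isDirected
    fun b hb a ha => hM.tensor_comm (hNY a ha b hb)
  exact ⟨N, N', hN, hN', hXN, hYN', fun a ha b hb => hM.tensor_comm (hNN' b hb a ha)⟩

/-! ### Finite descriptions of classical parts. -/

/-- The conjunction of `α` with the strong negations of the members of `Γ`. -/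
def literals (α : PLForm PS) : List (PLForm PS) → PTLForm PS
  | [] => cl α
  | γ :: Γ => (literals α Γ).conj (cl γ).sneg

theorem literals_mem (hM : IsMCS M) {α : PLForm PS} {Γ : List (PLForm PS)} :
    literals α Γ ∈ M ↔ cl α ∈ M ∧ ∀ γ ∈ Γ, cl γ ∉ M := by
  induction Γ with
  | nil => simp [literals]
  | cons γ Γ ih =>
    simp only [literals, hM.conj_mem, ih, hM.neg_mem, List.forall_mem_cons]
    tauto

theorem literals_mem_of_tensor (hM : IsMCS M) {α : PLForm PS} {Γ : List (PLForm PS)}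
    (h : (cl α).tensor (literals α Γ) ∈ M) : literals α Γ ∈ M := by
  refine hM.literals_mem.2 ⟨?_, fun γ hγ => ?_⟩
  · have := hM.tensor_cl.1 (hM.tensor_mono h fun N hN h => (hN.literals_mem.1 h).1)
    exact hM.cl_mem_iff.2 fun s hs => (this s hs).elim id id
  · refine (hM.neg_mem _).1 (hM.sneg_cl_mem_of_tensor (hM.tensor_mono h fun N hN h => ?_))
    exact (hN.neg_mem _).2 ((hN.literals_mem.1 h).2 γ hγ)

/-- As `α → γ` fails, some subteam satisfies `α` but not `γ`. By laxness it can be split off while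
keeping `φ ⊗ literals α Γ`, and then merged into the right part, where `α` persists and each `∼γ` is
inherited upwards. -/
theorem tensor_literals_cons (hM : IsMCS M) {α γ : PLForm PS} {Γ : List (PLForm PS)}
    {φ : PTLForm PS} (h : φ.tensor (literals α Γ) ∈ M) (hγ : cl (α.imp γ) ∉ M) :
    φ.tensor (literals α (γ :: Γ)) ∈ M := by
  have h₁ : (cl α.neg).tensor (cl α) ∈ M :=
    hM.tensor_cl.2 fun s _ => by simp only [PLForm.Sat]; tauto
  have h₂ : (cl α.neg).tensor ((cl α).conj (cl γ).sneg) ∈ M := by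
    rcases hM.tensor_or h₁ (θ := (cl α).conj (cl γ).sneg) (θ' := cl γ) (fun N hN h => by
      rw [hN.conj_mem, hN.neg_mem]; tauto) with h | h
    · exact h
    · refine absurd (hM.cl_mem_iff.2 fun s hs => ?_) hγ
      have := hM.tensor_cl.1 h s hs
      simp only [PLForm.Sat] at this ⊢
      tauto
  have h₃ := hM.tensor_left_comm (hM.tensor_comm (hM.tensor_lax h h₂))
  refine hM.tensor_mono h₃ fun N hN h => hN.conj_mem.2 ⟨hN.literals_mem_of_tensor ?_, ?_⟩
  · exact hN.tensor_comm (hN.tensor_mono (hN.tensor_comm h) fun _ hK h => (hK.conj_mem.1 h).1)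
  · exact hN.sneg_cl_mem_of_tensor
      (hN.tensor_mono (hN.tensor_comm h) fun _ hK h => (hK.conj_mem.1 h).2)

theorem tensor_literals (hM : IsMCS M) {α : PLForm PS} {Γ : List (PLForm PS)}
    {φ : PTLForm PS} (h : φ.tensor (cl α) ∈ M) (hΓ : ∀ γ ∈ Γ, cl (α.imp γ) ∉ M) :
    φ.tensor (literals α Γ) ∈ M := by
  induction Γ with
  | nil => exact h
  | cons γ Γ ih =>
    rw [List.forall_mem_cons] at hΓ
    exact hM.tensor_literals_cons (ih hΓ.2) hΓ.1

/-- The formulas describing the classical part of `M`. -/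
def diagram (M : Set (PTLForm PS)) : Set (PTLForm PS) :=
  {φ | ∃ α Γ, cl α ∈ M ∧ (∀ γ ∈ Γ, cl γ ∉ M) ∧ φ = literals α Γ}

theorem isDirected_diagram [Nonempty PS] (hM : IsMCS M) : IsDirected (diagram M) := by
  refine ⟨?_, ?_⟩
  · exact ⟨_, _, [], hM.isTheory_flat.imp_self (.atom (Classical.arbitrary PS)), by simp, rfl⟩
  · rintro _ ⟨α, Γ, hα, hΓ, rfl⟩ _ ⟨β, Δ, hβ, hΔ, rfl⟩
    have hand : ∀ N : Set (PTLForm PS), IsMCS N →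
        (cl (α.imp β.neg).neg ∈ N ↔ cl α ∈ N ∧ cl β ∈ N) := by
      intro N hN
      simp only [hN.cl_mem_iff, PLForm.Sat, ← forall_and]
      refine forall₂_congr fun s _ => ?_
      tauto
    refine ⟨literals (α.imp β.neg).neg (Γ ++ Δ), ⟨_, _, (hand M hM).2 ⟨hα, hβ⟩, ?_, rfl⟩, ?_⟩
    · simp only [List.mem_append]
      rintro γ (hγ | hγ)
      exacts [hΓ γ hγ, hΔ γ hγ]
    · intro N hN h
      rw [hN.literals_mem, hand N hN] at h
      simp only [List.mem_append] at h
      exact ⟨hN.literals_mem.2 ⟨h.1.1, fun γ hγ => h.2 γ (Or.inl hγ)⟩,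
        hN.literals_mem.2 ⟨h.1.2, fun γ hγ => h.2 γ (Or.inr hγ)⟩⟩

theorem cl_mem_iff_of_diagram_subset {N : Set (PTLForm PS)} (hM : IsMCS M) (hN : IsMCS N)
    (h : diagram M ⊆ N) (α : PLForm PS) : cl α ∈ M ↔ cl α ∈ N := by
  refine ⟨fun hα => h ⟨α, [], hα, by simp, rfl⟩, fun hα => by_contra fun hn => ?_⟩
  -- A tautology as positive part isolates the single negative literal `∼α`.
  have hm : literals (α.imp α) [α] ∈ N :=
    h ⟨α.imp α, [α], hM.isTheory_flat.imp_self α, by simpa using hn, rfl⟩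
  exact (hN.literals_mem.1 hm).2 α (by simp) hα

/-- A classical formula failing in one part of a split fails in the whole; this supplies the
hypothesis of `tensor_literals`. -/
theorem imp_not_mem_of_split [Nonempty PS] {N N' : Set (PTLForm PS)} (hM : IsMCS M) (hN : IsMCS N)
    (hN' : IsMCS N') (h : ∀ a ∈ N, ∀ b ∈ N', a.tensor b ∈ M) {α γ : PLForm PS}
    (hα : cl α ∈ N') (hγ : cl γ ∉ N') : cl (α.imp γ) ∉ M := by
  obtain ⟨a, ha⟩ := hN.isDirected.1
  refine (hM.neg_mem _).1 (hM.sneg_cl_mem_of_tensor (h a ha _ ((hN'.neg_mem _).2 ?_)))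
  exact fun hn => hγ (hN'.isTheory_flat.mp hn hα)

/-! ### The truth lemma, completeness and compactness. -/

/-- A maximal consistent set is determined by its classical part. -/
theorem mem_iff_of_cl_mem_iff [Nonempty PS] (φ : PTLForm PS) : ∀ {M M' : Set (PTLForm PS)}, IsMCS M → IsMCS M' →
    (∀ α, cl α ∈ M ↔ cl α ∈ M') → (φ ∈ M ↔ φ ∈ M') := by
  induction φ with
  | cl α => exact fun _ _ h => h α
  | sneg φ ih =>
    intro M M' hM hM' h
    rw [hM.neg_mem, hM'.neg_mem, ih hM hM' h]
  | mimp φ ψ ih ih' =>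
    intro M M' hM hM' h
    rw [hM.imp_mem, hM'.imp_mem, ih hM hM' h, ih' hM hM' h]
  | limp φ ψ ih ih' =>
    have key : ∀ {M M' : Set (PTLForm PS)}, IsMCS M → IsMCS M' →
        (∀ α, cl α ∈ M ↔ cl α ∈ M') → φ.tensor ψ.sneg ∈ M → φ.tensor ψ.sneg ∈ M' := by
      intro M M' hM hM' h hm
      obtain ⟨N₁, N₂, hN₁, hN₂, h₁, h₂, hs⟩ := hM.exists_split (isDirected_singleton φ)
        (isDirected_singleton ψ.sneg) (by rintro _ rfl _ rfl; exact hm)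
      have hs' : ∀ a ∈ N₂, ∀ b ∈ N₁, a.tensor b ∈ M :=
        fun a ha b hb => hM.tensor_comm (hs b hb a ha)
      -- Copy the split to `M'`: containing the diagrams forces `K₁`, `K₂` to have the classical
      -- parts of `N₁`, `N₂`.
      obtain ⟨K₁, K₂, hK₁, hK₂, hd₁, hd₂, ht⟩ := hM'.exists_split hN₁.isDirected_diagram
        hN₂.isDirected_diagram (by
          rintro _ ⟨α, Γ, hα, hΓ, rfl⟩ _ ⟨β, Δ, hβ, hΔ, rfl⟩
          have h₀ : (cl α).tensor (cl β) ∈ M' := by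
            have : team M = team M' := by simp only [team, h]
            rw [hM'.tensor_cl, ← this, ← hM.tensor_cl]
            exact hs _ hα _ hβ
          refine hM'.tensor_literals (hM'.tensor_comm
            (hM'.tensor_literals (hM'.tensor_comm h₀) ?_)) ?_
          · exact fun γ hγ => (h _).not.1 (hM.imp_not_mem_of_split hN₂ hN₁ hs' hα (hΓ γ hγ))
          · exact fun γ hγ => (h _).not.1 (hM.imp_not_mem_of_split hN₁ hN₂ hs hβ (hΔ γ hγ)))
      refine ht _ ((ih hN₁ hK₁ (hN₁.cl_mem_iff_of_diagram_subset hK₁ hd₁)).1 (h₁ rfl)) _ ?_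
      have hψ := ih' hN₂ hK₂ (hN₂.cl_mem_iff_of_diagram_subset hK₂ hd₂)
      exact (hK₂.neg_mem _).2 (hψ.not.1 ((hN₂.neg_mem _).1 (h₂ rfl)))
    intro M M' hM hM' h
    rw [hM.limp_mem, hM'.limp_mem]
    exact not_congr ⟨key hM hM' h, key hM' hM fun α => (h α).symm⟩

/-- The truth lemma. -/
theorem sat_team_iff [Nonempty PS] (hM : IsMCS M) (φ : PTLForm PS) : Sat (team M) φ ↔ φ ∈ M :=
  mem_iff_of_cl_mem_iff φ (isMCS_setOf_sat (team M)) hM fun _ => hM.cl_mem_iff.symm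

end IsMCS

theorem completeness {PS : Type*} [Nonempty PS] {Φ : Set (PTLForm PS)} {φ : PTLForm PS}
    (h : PTLForm.Entails Φ φ) : (sysH0LS PS).Derives Φ φ := by
  by_contra hn
  obtain ⟨M, hM, hc, hφ⟩ := (isTheory_derives Φ).exists_complete_not_mem (a := φ) hn
  have hM' : IsMCS M := ⟨hc, fun ψ hψ => hM (derives_mono hψ (Set.empty_subset _))⟩
  exact hφ ((hM'.sat_team_iff φ).1
    (h _ fun ψ hψ => (hM'.sat_team_iff ψ).2 (hM (.premise hψ))))

theorem entails_compact {PS : Type*} [Nonempty PS] {Φ : Set (PTLForm PS)} {φ : PTLForm PS}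
    (h : PTLForm.Entails Φ φ) : ∃ Ψ ⊆ Φ, Ψ.Finite ∧ PTLForm.Entails Ψ φ := by
  obtain ⟨Ψ, hs, hf, hd⟩ := exists_finite_derives (completeness h)
  exact ⟨Ψ, hs, hf, soundness hd⟩

theorem satisfiable_compact {PS : Type*} [Nonempty PS] {Φ : Set (PTLForm PS)}
    (h : ∀ Ψ ⊆ Φ, Ψ.Finite → PTLForm.Satisfiable Ψ) : PTLForm.Satisfiable Φ := by
  by_contra hn
  rcases Φ.eq_empty_or_nonempty with rfl | ⟨φ, hφ⟩
  · exact hn (h ∅ le_rfl Set.finite_empty)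
  -- An unsatisfiable `Φ` entails this contradiction.
  obtain ⟨Ψ, hs, hf, he⟩ := entails_compact (Φ := Φ) (φ := (φ.mimp φ).sneg)
    fun T hT => (hn ⟨T, hT⟩).elim
  obtain ⟨T, hT⟩ := h Ψ hs hf
  exact he T hT id

theorem mainTheorem3 {PS : Type*} [Countable PS] [Infinite PS] :
    -- soundness
    (∀ (Φ : Set (PTLForm PS)) (φ : PTLForm PS),
      (sysH0LS PS).Derives Φ φ → PTLForm.Entails Φ φ) ∧
    -- completeness
    (∀ (Φ : Set (PTLForm PS)) (φ : PTLForm PS),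
      PTLForm.Entails Φ φ → (sysH0LS PS).Derives Φ φ) ∧
    -- compactness, for satisfiability and for entailment
    (∀ Φ : Set (PTLForm PS),
      (∀ Ψ : Set (PTLForm PS), Ψ ⊆ Φ → Ψ.Finite → PTLForm.Satisfiable Ψ) →
        PTLForm.Satisfiable Φ) ∧
    (∀ (Φ : Set (PTLForm PS)) (φ : PTLForm PS), PTLForm.Entails Φ φ →
      ∃ Ψ : Set (PTLForm PS), Ψ ⊆ Φ ∧ Ψ.Finite ∧ PTLForm.Entails Ψ φ) := by
  exact ⟨fun _ _ => soundness, fun _ _ => completeness, fun _ => satisfiable_compact,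
    fun _ _ => entails_compact⟩
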